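/- **Conventions.** An algebra is a complex vector space $\mathrm A$ with a bilinear multiplication $x\cdot y$ (not necessarily associative, commutative or unital); put $x\circ y=x\cdot y+y\cdot x$. Let $\mathrm A^1=\mathrm A$ and $\mathrm A^n=\sum_{i+j=n,\ i,j\ge 1}\mathrm A^i\cdot \mathrm A^j$. The algebra is *nilpotent* if $\mathrm A^n=0$ for some $n$, and *2-step nilpotent* if $\mathrm A^3=0$. It is an $\mathcal A\mathrm{BD}$*-algebra* if for all $x,y,z$ $$x\cdot(y\circ z)=-\big((x\cdot y)\circ z+y\circ(x\cdot z)\big),\qquad (y\circ z)\cdot x=-\big((y\cdot x)\circ z+y\circ(z\cdot x)\big),$$ a *symmetric Leibniz algebra* if for all $x,y,z$ $$x\cdot(y\cdot z)=(x\cdot y)\cdot z+y\cdot(x\cdot z),\qquad (y\cdot z)\cdot x=(y\cdot x)\cdot z+y\cdot(z\cdot x),$$ and a *nilalgebra with nilindex $3$* if $(x\cdot x)\cdot x=x\cdot(x\cdot x)=0$ for all $x$. **Theorem.** Let $(\mathcal A,\cdot)$ be a complex $4$-dimensional nilpotent $\mathcal A\mathrm{BD}$-algebra. Then $(\mathcal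 A,\cdot)$ is 2-step nilpotent, or it is isomorphic to one of the following algebras with basis $e_1,e_2,e_3,e_4$ (products of basis vectors that are not listed are zero): - $\mathcal A^4_1$: $e_1\cdot e_2=e_3,\ e_1\cdot e_3=e_4,\ e_2\cdot e_1=-e_3,\ e_3\cdot e_1=-e_4$; - $\mathcal A^4_2$: $e_1\cdot e_2=-e_3+e_4,\ e_1\cdot e_3=-e_4,\ e_2\cdot e_1=e_3,\ e_3\cdot e_1=e_4$; - $\mathcal A^4_3$: $e_1\cdot e_2=-e_3,\ e_1\cdot e_3=-e_4,\ e_2\cdot e_1=e_3,\ e_2\cdot e_2=e_4,\ e_3\cdot e_1=e_4$; - $\mathcal A^4_4$: $e_1\cdot e_1=e_4,\ e_1\cdot e_2=-e_3,\ e_1\cdot e_3=-e_4,\ e_2\cdot e_1=e_3,\ e_2\cdot e_2=e_4,\ e_3\cdot e_1=e_4$; - $\mathcal A^4_5$: $e_1\cdot e_1=e_4,\ e_1\cdot e_2=-e_3,\ e_1\cdot e_3=-e_4,\ e_2\cdot e_1=e_3,\ e_3\cdot e_1=e_4$. In particular: **A.** A complex $4$-dimensional algebra is a nilpotent symmetric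 Leibniz algebra if and only if it is a nilpotent $\mathcal A\mathrm{BD}$-algebra. **B.** There are infinitely many pairwise non-isomorphic complex $4$-dimensional nilpotent nilalgebras with nilindex $3$ that are not $\mathcal A\mathrm{BD}$-algebras. -/

import Mathlib

/- A (not necessarily associative or unital) algebra over `K` is a `K`-module `A` together with a
bilinear multiplication `μ : A →ₗ[K] A →ₗ[K] A`; the product `x · y` is `μ x y`. -/

namespace ABD

section General

variable {K : Type*} [CommRing K] {A : Type*} [AddCommGroup A] [Module K A]
  {B : Type*} [AddCommGroup B] [Module K B]

/-- The symmetrized product `x ∘ y = x · y + y · x`. -/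
def circ (μ : A →ₗ[K] A →ₗ[K] A) (x y : A) : A := μ x y + μ y x

/-- Algebras of anti-biderivation-type: all left and all right multiplications are
antiderivations of the symmetrized algebra `(A, ∘)`. -/
def IsABD (μ : A →ₗ[K] A →ₗ[K] A) : Prop :=
  (∀ x y z : A, μ x (circ μ y z) = -(circ μ (μ x y) z + circ μ y (μ x z))) ∧
  (∀ x y z : A, μ (circ μ y z) x = -(circ μ (μ y x) z + circ μ y (μ z x)))

/-- Symmetric (two-sided) Leibniz algebras: all left and all right multiplications are
derivations. -/
def IsSymmetricLeibniz (μ : A →ₗ[K] A →ₗ[K] A) : Prop :=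
  (∀ x y z : A, μ x (μ y z) = μ (μ x y) z + μ y (μ x z)) ∧
  (∀ x y z : A, μ (μ y z) x = μ (μ y x) z + μ y (μ z x))

/-- The powers `A¹ = A`, `Aⁿ = ∑_{i + j = n, i, j ≥ 1} Aⁱ Aʲ` (and, by convention, `A⁰ = A`),
where `Aⁱ Aʲ` is the span of all products. -/
def power (μ : A →ₗ[K] A →ₗ[K] A) : ℕ → Submodule K A
  | 0 => ⊤
  | 1 => ⊤
  | n + 2 => ⨆ i : Fin (n + 1), Submodule.map₂ μ (power μ ((i : ℕ) + 1)) (power μ (n + 1 - (i : ℕ)))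
termination_by n => n
decreasing_by all_goals omega

/-- `A` is nilpotent if `Aⁿ = 0` for some `n`. -/
def IsNilpotentAlg (μ : A →ₗ[K] A →ₗ[K] A) : Prop := ∃ n : ℕ, power μ n = ⊥

/-- `A` is 2-step nilpotent if `A³ = 0`, i.e. all products of three elements vanish
(algebras with zero multiplication are included). -/
def IsTwoStepNilpotent (μ : A →ₗ[K] A →ₗ[K] A) : Prop := power μ 3 = ⊥

/-- Nilalgebras with nilindex 3: `x³ = 0` for all `x`, for both bracketings of `x³`. -/
def IsNilIndexThree (μ : A →ₗ[K] A →ₗ[K] A) : Prop :=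
  ∀ x : A, μ (μ x x) x = 0 ∧ μ x (μ x x) = 0

/-- Isomorphism of algebras. -/
def Isomorphic (μ : A →ₗ[K] A →ₗ[K] A) (ν : B →ₗ[K] B →ₗ[K] B) : Prop :=
  ∃ φ : A ≃ₗ[K] B, ∀ x y : A, φ (μ x y) = ν (φ x) (φ y)

end General

/-- The 4-dimensional complex algebra with basis `e₁, e₂, e₃, e₄` (the standard basis of `ℂ⁴`)
and multiplication table `c` (indexed from `0`). -/
noncomputable def ofTable (c : Fin 4 → Fin 4 → (Fin 4 → ℂ)) :
    (Fin 4 → ℂ) →ₗ[ℂ] (Fin 4 → ℂ) →ₗ[ℂ] (Fin 4 → ℂ) :=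
  LinearMap.mk₂ ℂ (fun x y => ∑ i, ∑ j, (x i * y j) • c i j)
    (by intro x x' y; simp only [Pi.add_apply, add_mul, add_smul, Finset.sum_add_distrib])
    (by intro a x y; simp only [Pi.smul_apply, smul_eq_mul, mul_assoc, mul_smul, Finset.smul_sum])
    (by intro x y y'; simp only [Pi.add_apply, mul_add, add_smul, Finset.sum_add_distrib])
    (by
      intro a x y
      simp only [Pi.smul_apply, smul_eq_mul, mul_left_comm _ a, mul_smul, Finset.smul_sum])

/-- The table really is the multiplication table in the standard basis. -/
theorem ofTable_single (c : Fin 4 → Fin 4 → (Fin 4 → ℂ)) (i j : Fin 4) :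
    ofTable c (Pi.single i 1) (Pi.single j 1) = c i j := by
  simp [ofTable, Pi.single_apply, ite_smul]

/-- The basis vectors `e₁, e₂, e₃, e₄` of `ℂ⁴`. -/
def e₁ : Fin 4 → ℂ := Pi.single 0 1
def e₂ : Fin 4 → ℂ := Pi.single 1 1
def e₃ : Fin 4 → ℂ := Pi.single 2 1
def e₄ : Fin 4 → ℂ := Pi.single 3 1

/-- `e₁e₂ = e₃, e₁e₃ = e₄, e₂e₁ = -e₃, e₃e₁ = -e₄`. The row `i` and column `j` of the table
holds the product of the `i`-th and the `j`-th basis vector. -/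
noncomputable def A41 : (Fin 4 → ℂ) →ₗ[ℂ] (Fin 4 → ℂ) →ₗ[ℂ] (Fin 4 → ℂ) :=
  ofTable ![![  0,  e₃, e₄, 0],
            ![-e₃,   0,  0, 0],
            ![-e₄,   0,  0, 0],
            ![  0,   0,  0, 0]]

/-- `e₁e₂ = -e₃ + e₄, e₁e₃ = -e₄, e₂e₁ = e₃, e₃e₁ = e₄`. -/
noncomputable def A42 : (Fin 4 → ℂ) →ₗ[ℂ] (Fin 4 → ℂ) →ₗ[ℂ] (Fin 4 → ℂ) :=
  ofTable ![![ 0, -e₃ + e₄, -e₄, 0],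
            ![e₃,        0,   0, 0],
            ![e₄,        0,   0, 0],
            ![ 0,        0,   0, 0]]

/-- `e₁e₂ = -e₃, e₁e₃ = -e₄, e₂e₁ = e₃, e₂e₂ = e₄, e₃e₁ = e₄`. -/
noncomputable def A43 : (Fin 4 → ℂ) →ₗ[ℂ] (Fin 4 → ℂ) →ₗ[ℂ] (Fin 4 → ℂ) :=
  ofTable ![![ 0, -e₃, -e₄, 0],
            ![e₃,  e₄,   0, 0],
            ![e₄,   0,   0, 0],
            ![ 0,   0,   0, 0]]

/-- `e₁e₁ = e₄, e₁e₂ = -e₃, e₁e₃ = -e₄, e₂e₁ = e₃, e₂e₂ = e₄, e₃e₁ = e₄`. -/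
noncomputable def A44 : (Fin 4 → ℂ) →ₗ[ℂ] (Fin 4 → ℂ) →ₗ[ℂ] (Fin 4 → ℂ) :=
  ofTable ![![e₄, -e₃, -e₄, 0],
            ![e₃,  e₄,   0, 0],
            ![e₄,   0,   0, 0],
            ![ 0,   0,   0, 0]]

/-- `e₁e₁ = e₄, e₁e₂ = -e₃, e₁e₃ = -e₄, e₂e₁ = e₃, e₃e₁ = e₄`. -/
noncomputable def A45 : (Fin 4 → ℂ) →ₗ[ℂ] (Fin 4 → ℂ) →ₗ[ℂ] (Fin 4 → ℂ) :=
  ofTable ![![e₄, -e₃, -e₄, 0],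
            ![e₃,   0,   0, 0],
            ![e₄,   0,   0, 0],
            ![ 0,   0,   0, 0]]

end ABD

/-! Anti-biderivation and symmetric Leibniz algebras both satisfy x³ = 0 and x²x² = 0. A nilpotent
algebra with these properties and one generator has A³ = 0, so in dimension 4 with A³ ≠ 0 the
dimensions of A, A², A³ are 4, 2, 1. Then A³ = Kv annihilates A and all squares lie in A³
(`IsNilpotentAlg.exists_generators`), so the product is anticommutative modulo v. Either identity
then leads to the same multiplication table (`IsNilpotentAlg.exists_isFrame`), given by a binary
quadratic form (α, γ, β), where x² = Q(x)v on the span of the generators, and a nonzero linear form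
(l, m), the action on c = ab. Conversely, every such table satisfies both identities, which gives A.

The classification is that of pairs (quadratic form, nonzero linear form) under change of
generators: the linear form becomes (1, 0), and Q is then sorted by its value on the kernel line and
its discriminant. For B, the ratio t between (xy)z and z(xy) is an isomorphism invariant of a
one-parameter family. -/

namespace ABD

/-! ### Powers and nilpotency -/

section Powers

variable {K : Type*} [Field K] {A : Type*} [AddCommGroup A] [Module K A]
  {μ : A →ₗ[K] A →ₗ[K] A}

theorem power_one : power μ 1 = ⊤ := by rw [power]

theorem power_succ_succ (n : ℕ) : power μ (n + 2) =
    ⨆ i : Fin (n + 1), Submodule.map₂ μ (power μ ((i : ℕ) + 1)) (power μ (n + 1 - (i : ℕ))) := by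
  rw [power]

theorem mul_mem_power {i j : ℕ} {x y : A} (hx : x ∈ power μ (i + 1)) (hy : y ∈ power μ (j + 1)) :
    μ x y ∈ power μ (i + j + 2) := by
  rw [power_succ_succ]
  refine Submodule.mem_iSup_of_mem (⟨i, by omega⟩ : Fin (i + j + 1)) ?_
  refine Submodule.apply_mem_map₂ _ hx ?_
  have : i + j + 1 - i = j + 1 := by omega
  simpa [this] using hy

theorem mul_left_mem_power {n : ℕ} (x : A) {y : A} (hy : y ∈ power μ (n + 1)) :
    μ x y ∈ power μ (n + 2) := by
  have hx : x ∈ power μ (0 + 1) := by simp [power_one]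
  simpa using mul_mem_power hx hy

theorem mul_right_mem_power {n : ℕ} (x : A) {y : A} (hy : y ∈ power μ (n + 1)) :
    μ y x ∈ power μ (n + 2) := by
  have hx : x ∈ power μ (0 + 1) := by simp [power_one]
  simpa using mul_mem_power hy hx

theorem mul_mem_power_two (x y : A) : μ x y ∈ power μ 2 :=
  mul_left_mem_power x (n := 0) (by simp [power_one])

theorem power_two_le {S : Submodule K A} (h : ∀ x y, μ x y ∈ S) : power μ 2 ≤ S := by
  rw [power_succ_succ 0]
  exact iSup_le fun i => Submodule.map₂_le.2 fun x _ y _ => h x y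

theorem power_three_le {S : Submodule K A}
    (h : ∀ x, ∀ y ∈ power μ 2, μ x y ∈ S ∧ μ y x ∈ S) : power μ 3 ≤ S := by
  rw [power_succ_succ 1]
  refine iSup_le fun i => Submodule.map₂_le.2 fun x hx y hy => ?_
  fin_cases i
  · exact (h x y hy).1
  · exact (h y x hx).2

theorem power_four_le {S : Submodule K A}
    (h : ∀ x, ∀ y ∈ power μ 3, μ x y ∈ S ∧ μ y x ∈ S)
    (h' : ∀ x ∈ power μ 2, ∀ y ∈ power μ 2, μ x y ∈ S) : power μ 4 ≤ S := by
  rw [power_succ_succ 2]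
  refine iSup_le fun i => Submodule.map₂_le.2 fun x hx y hy => ?_
  fin_cases i
  · exact (h x y hy).1
  · exact h' x hx y hy
  · exact (h y x hx).2

theorem power_three_le_power_two : power μ 3 ≤ power μ 2 :=
  power_three_le fun x y _ => ⟨mul_mem_power_two x y, mul_mem_power_two y x⟩

theorem IsTwoStepNilpotent.mul_mul (h : IsTwoStepNilpotent μ) (x y z : A) :
    μ x (μ y z) = 0 ∧ μ (μ y z) x = 0 := by
  have h' : power μ 3 = ⊥ := h
  have h1 := mul_left_mem_power x (mul_mem_power_two (μ := μ) y z)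
  have h2 := mul_right_mem_power x (mul_mem_power_two (μ := μ) y z)
  rw [h'] at h1 h2
  exact ⟨by simpa using h1, by simpa using h2⟩

theorem IsTwoStepNilpotent.isABD (h : IsTwoStepNilpotent μ) : IsABD μ := by
  constructor <;> intro x y z <;>
    simp [circ, fun x y z => (h.mul_mul x y z).1, fun x y z => (h.mul_mul x y z).2]

theorem IsTwoStepNilpotent.isSymmetricLeibniz (h : IsTwoStepNilpotent μ) :
    IsSymmetricLeibniz μ := by
  constructor <;> intro x y z <;>
    simp [fun x y z => (h.mul_mul x y z).1, fun x y z => (h.mul_mul x y z).2]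

/-- A subspace of a nilpotent algebra contained in all powers vanishes. -/
theorem IsNilpotentAlg.eq_bot_of_le (h : IsNilpotentAlg μ) {S : Submodule K A}
    (hS : ∀ n, S ≤ power μ (n + 1)) : S = ⊥ := by
  obtain ⟨n, hn⟩ := h
  rcases n with _ | n
  -- As A⁰ = A by convention, A⁰ = 0 means that A itself is zero.
  · refine eq_bot_iff.2 (le_top.trans ?_)
    rw [← hn, power]
  · exact eq_bot_iff.2 (hn ▸ hS n)

/-- In a nilpotent algebra, `S ≤ A S + S A` forces `S = 0`. -/
theorem IsNilpotentAlg.eq_bot_of_le_mul (h : IsNilpotentAlg μ) {S : Submodule K A}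
    (hS : S ≤ Submodule.map₂ μ ⊤ S ⊔ Submodule.map₂ μ S ⊤) : S = ⊥ := by
  refine h.eq_bot_of_le fun n => ?_
  induction n with
  | zero => simp [power_one]
  | succ n ih =>
    refine hS.trans (sup_le ?_ ?_)
    · exact Submodule.map₂_le.2 fun x _ y hy => mul_left_mem_power x (ih hy)
    · exact Submodule.map₂_le.2 fun x hx y _ => mul_right_mem_power y (ih hx)

/-- A nonzero eigenvalue t could be scaled to 1 by passing to t⁻¹x, so that Kv ⊆ A·Kv, forcing v =
0. -/
theorem IsNilpotentAlg.mul_eq_zero_of_mem_span (h : IsNilpotentAlg μ) {x v : A}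
    (hv : μ x v ∈ K ∙ v) : μ x v = 0 := by
  obtain ⟨t, ht⟩ := Submodule.mem_span_singleton.1 hv
  rcases eq_or_ne t 0 with rfl | h0
  · simpa using ht.symm
  have : (K ∙ v) = ⊥ := by
    refine h.eq_bot_of_le_mul (le_sup_of_le_left ?_)
    rw [Submodule.span_singleton_le_iff_mem]
    have := Submodule.apply_mem_map₂ μ (Submodule.mem_top (x := t⁻¹ • x))
      (Submodule.mem_span_singleton_self (R := K) v)
    simpa [← ht, smul_smul, h0] using this
  simp [Submodule.span_singleton_eq_bot.1 this]

theorem IsNilpotentAlg.mul_eq_zero_of_mem_span' (h : IsNilpotentAlg μ) {x v : A}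
    (hv : μ v x ∈ K ∙ v) : μ v x = 0 := by
  obtain ⟨t, ht⟩ := Submodule.mem_span_singleton.1 hv
  rcases eq_or_ne t 0 with rfl | h0
  · simpa using ht.symm
  have : (K ∙ v) = ⊥ := by
    refine h.eq_bot_of_le_mul (le_sup_of_le_right ?_)
    rw [Submodule.span_singleton_le_iff_mem]
    have := Submodule.apply_mem_map₂ μ (Submodule.mem_span_singleton_self (R := K) v)
      (Submodule.mem_top (x := t⁻¹ • x))
    simpa [← ht, smul_smul, h0] using this
  simp [Submodule.span_singleton_eq_bot.1 this]

theorem IsNilpotentAlg.power_two_lt_top [Nontrivial A] (h : IsNilpotentAlg μ) :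
    power μ 2 < ⊤ := by
  refine lt_top_iff_ne_top.2 fun h2 => ?_
  refine top_ne_bot (α := Submodule K A) (h.eq_bot_of_le_mul (le_sup_of_le_left ?_))
  rw [← h2]
  exact power_two_le fun x y => Submodule.apply_mem_map₂ _ (h2 ▸ trivial) (h2 ▸ trivial)

theorem IsNilpotentAlg.power_three_lt_power_two (h : IsNilpotentAlg μ)
    (h3 : power μ 3 ≠ ⊥) : power μ 3 < power μ 2 := by
  refine lt_of_le_of_ne power_three_le_power_two fun h2 => h3 ?_
  refine h.eq_bot_of_le_mul (power_three_le fun x y hy => ⟨?_, ?_⟩) <;> rw [← h2] at hy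
  · exact Submodule.mem_sup_left (Submodule.apply_mem_map₂ _ trivial hy)
  · exact Submodule.mem_sup_right (Submodule.apply_mem_map₂ _ hy trivial)

theorem exists_span_sup_eq_top [FiniteDimensional K A] (S : Submodule K A) {k : ℕ}
    (hk : Module.finrank K S + k = Module.finrank K A) :
    ∃ u : Fin k → A, S ⊔ Submodule.span K (Set.range u) = ⊤ := by
  obtain ⟨T, hT⟩ := Submodule.exists_isCompl S
  have hf := Submodule.finrank_add_eq_of_isCompl hT
  let b := Module.finBasisOfFinrankEq K T (n := k) (by omega)
  refine ⟨fun i => b i, ?_⟩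
  have : Submodule.span K (Set.range fun i => (b i : A)) = T := by
    have := congrArg (Submodule.map T.subtype) b.span_eq
    rw [Submodule.map_span, ← Set.range_comp] at this
    simpa [Function.comp_def] using this
  rw [this, hT.sup_eq_top]

theorem IsSymmetricLeibniz.isNilIndexThree (h : IsSymmetricLeibniz μ) : IsNilIndexThree μ := by
  intro x
  have h1 := h.1 x x x
  have h2 := h.2 x x x
  exact ⟨by simpa using h1, by simpa using h2⟩

/-- Applied to x, x, x², the derivation identity has x(x x²) on both sides. -/
theorem IsSymmetricLeibniz.sq_mul_sq (h : IsSymmetricLeibniz μ) (x : A) :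
    μ (μ x x) (μ x x) = 0 := by
  simpa using h.1 x x (μ x x)

end Powers

/-! ### Cubes and squares in anti-biderivation algebras -/

section NilIndex

variable {K : Type*} [Field K] [CharZero K] {A : Type*} [AddCommGroup A] [Module K A]
  {μ : A →ₗ[K] A →ₗ[K] A}

/-- With all arguments equal, the cubes P = x x² and Q = x² x satisfy 4P + 2Q = 0 and 2P + 4Q = 0, a
system of determinant 12. -/
theorem IsABD.isNilIndexThree (h : IsABD μ) : IsNilIndexThree μ := by
  intro x
  have h1 := h.1 x x x
  have h2 := h.2 x x x
  simp only [circ, map_add, LinearMap.add_apply] at h1 h2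
  constructor
  · linear_combination (norm := module) (-1 / 6 : K) • h1 + (1 / 3 : K) • h2
  · linear_combination (norm := module) (1 / 3 : K) • h1 - (1 / 6 : K) • h2

theorem IsABD.sq_mul_sq (h : IsABD μ) (x : A) : μ (μ x x) (μ x x) = 0 := by
  have h1 := h.1 (μ x x) x x
  simp only [circ, map_add, h.isNilIndexThree x] at h1
  simp only [map_zero, LinearMap.zero_apply] at h1
  linear_combination (norm := module) (1 / 2 : K) • h1

end NilIndex

/-! ### The common multiplication table -/

section Frames

variable {K : Type*} [Field K] {A : Type*} [AddCommGroup A] [Module K A]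
  {μ : A →ₗ[K] A →ₗ[K] A}

/-- The vectors `a`, `b`, `c`, `v` span the algebra, and multiply like a non-2-step nilpotent
4-dimensional algebra of anti-biderivation type, with structure constants `α, β, γ, l, m`. -/
structure IsFrame (μ : A →ₗ[K] A →ₗ[K] A) (a b c v : A) (α β γ l m : K) : Prop where
  span_eq : Submodule.span K {a, b, c, v} = ⊤
  aa : μ a a = α • v
  ab : μ a b = c
  ba : μ b a = -c + γ • v
  bb : μ b b = β • v
  ac : μ a c = l • v
  ca : μ c a = -(l • v)
  bc : μ b c = m • v
  cb : μ c b = -(m • v)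
  cc : μ c c = 0
  vx : ∀ x, μ v x = 0
  xv : ∀ x, μ x v = 0

namespace IsFrame

variable {a b c v : A} {α β γ l m : K}

theorem exists_eq (h : IsFrame μ a b c v α β γ l m) (x : A) :
    ∃ p q r s : K, x = p • a + q • b + r • c + s • v := by
  have hx : x ∈ Submodule.span K {a, b, c, v} := h.span_eq ▸ trivial
  simp only [Submodule.mem_span_insert, Submodule.mem_span_singleton] at hx
  obtain ⟨p, _, ⟨q, _, ⟨r, _, ⟨s, rfl⟩, rfl⟩, rfl⟩, rfl⟩ := hx
  exact ⟨p, q, r, s, by module⟩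

/-- Triple products are given by an alternating form and a linear form. -/
theorem exists_forms (h : IsFrame μ a b c v α β γ l m) :
    ∃ f g : A → K, ∀ x y z,
      μ x (μ y z) = ((l * f x + m * g x) * (f y * g z - g y * f z)) • v ∧
      μ (μ x y) z = -(((f x * g y - g x * f y) * (l * f z + m * g z)) • v) := by
  -- Any choice of coordinates will do: linearity of f and g is not needed, because they are only
  -- evaluated at x, y, z themselves.
  choose f g r s hx using h.exists_eq
  refine ⟨f, g, fun x y z => ?_⟩
  -- The v-component of a product is irrelevant to triple products, since v annihilates the algebra.
  have key (x y : A) : ∃ t : K, μ x y = (f x * g y - g x * f y) • c + t • v := by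
    refine ⟨f x * f y * α + g x * g y * β + g x * f y * γ
      + (f x * r y - r x * f y) * l + (g x * r y - r x * g y) * m, ?_⟩
    conv_lhs => rw [hx x, hx y]
    simp only [map_add, map_smul, LinearMap.add_apply, LinearMap.smul_apply, h.aa, h.ab, h.ba,
      h.bb, h.ac, h.ca, h.bc, h.cb, h.cc, h.vx, h.xv]
    module
  constructor
  · obtain ⟨t, ht⟩ := key y z
    rw [ht]
    conv_lhs => rw [hx x]
    simp only [map_add, map_smul, LinearMap.add_apply, LinearMap.smul_apply,
      h.ac, h.bc, h.cc, h.vx, h.xv]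
    module
  · obtain ⟨t, ht⟩ := key x y
    rw [ht]
    conv_lhs => rw [hx z]
    simp only [map_add, map_smul, LinearMap.add_apply, LinearMap.smul_apply,
      h.ca, h.cb, h.cc, h.vx, h.xv]
    module

/-- Here x(yz) = -x(zy) and (xy)z = -z(xy), so both sides of each identity vanish. -/
theorem isABD (h : IsFrame μ a b c v α β γ l m) : IsABD μ := by
  obtain ⟨f, g, hfg⟩ := h.exists_forms
  constructor <;> intro x y z <;>
  · simp only [circ, map_add, LinearMap.add_apply, fun x y z => (hfg x y z).1,
      fun x y z => (hfg x y z).2]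
    module

/-- With λ = lf + mg and ω = f ∧ g, both identities say that the cyclic sum of λ(x)ω(y, z) is zero.
That sum is λ ∧ f ∧ g, and λ is a combination of f and g. -/
theorem isSymmetricLeibniz (h : IsFrame μ a b c v α β γ l m) : IsSymmetricLeibniz μ := by
  obtain ⟨f, g, hfg⟩ := h.exists_forms
  constructor <;> intro x y z <;>
  · simp only [fun x y z => (hfg x y z).1, fun x y z => (hfg x y z).2]
    module

/-- Change of generators. -/
theorem change (h : IsFrame μ a b c v α β γ l m) (p q r s k : K)
    (hD : p * s - q * r ≠ 0) (hk : k ≠ 0) {α' β' γ' l' m' : K}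
    (hα : α' * k = p ^ 2 * α + p * q * γ + q ^ 2 * β)
    (hβ : β' * k = r ^ 2 * α + r * s * γ + s ^ 2 * β)
    (hγ : γ' * k = 2 * p * r * α + (p * s + q * r) * γ + 2 * q * s * β)
    (hl : l' * k = (p * s - q * r) * (p * l + q * m))
    (hm : m' * k = (p * s - q * r) * (r * l + s * m)) :
    ∃ a' b' c' v', IsFrame μ a' b' c' v' α' β' γ' l' m' := by
  have hc : μ (p • a + q • b) (r • a + s • b) =
      (p * s - q * r) • c + (p * r * α + q * r * γ + q * s * β) • v := by
    simp only [map_add, map_smul, LinearMap.add_apply, LinearMap.smul_apply, h.aa, h.ab, h.ba,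
      h.bb]
    module
  -- The quadratic form is substituted and divided by k. The linear form also picks up the
  -- determinant, because the new c is ps - qr times the old one modulo v.
  refine ⟨p • a + q • b, r • a + s • b, μ (p • a + q • b) (r • a + s • b), k • v, ?_, ?_, rfl,
    ?_, ?_, ?_, ?_, ?_, ?_, ?_, fun x => by simp [h.vx], fun x => by simp [h.xv]⟩
  · set S := Submodule.span K {p • a + q • b, r • a + s • b,
      μ (p • a + q • b) (r • a + s • b), k • v} with hS
    have h1 : p • a + q • b ∈ S := Submodule.subset_span (by simp)
    have h2 : r • a + s • b ∈ S := Submodule.subset_span (by simp)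
    have h3 : μ (p • a + q • b) (r • a + s • b) ∈ S := Submodule.subset_span (by simp)
    have h4 : k • v ∈ S := Submodule.subset_span (by simp)
    have hv : v ∈ S := (Submodule.smul_mem_iff _ hk).1 h4
    have hc' : c ∈ S := by
      rw [hc] at h3
      exact (Submodule.smul_mem_iff _ hD).1
        ((Submodule.add_mem_iff_left _ (S.smul_mem _ hv)).1 h3)
    -- Cramer's rule recovers a and b.
    have ha : a ∈ S := by
      refine (Submodule.smul_mem_iff _ hD).1 ?_
      convert S.sub_mem (S.smul_mem s h1) (S.smul_mem q h2) using 1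
      module
    have hb : b ∈ S := by
      refine (Submodule.smul_mem_iff _ hD).1 ?_
      convert S.sub_mem (S.smul_mem p h2) (S.smul_mem r h1) using 1
      module
    rw [eq_top_iff, ← h.span_eq, Submodule.span_le]
    rintro x (rfl | rfl | rfl | rfl) <;> assumption
  all_goals
    try rw [hc]
    try simp only [smul_smul, hα, hβ, hγ, hl, hm]
    simp only [map_add, map_smul, LinearMap.add_apply, LinearMap.smul_apply, h.aa, h.ab, h.ba,
      h.bb, h.ac, h.ca, h.bc, h.cb, h.cc, h.vx, h.xv]
    module

end IsFrame

end Frames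

/-! ### Normal forms over ℂ -/

section Normalization

variable {A : Type*} [AddCommGroup A] [Module ℂ A] {μ : A →ₗ[ℂ] A →ₗ[ℂ] A}

theorem isomorphic_ofTable (b : Module.Basis (Fin 4) ℂ A) {c : Fin 4 → Fin 4 → (Fin 4 → ℂ)}
    (h : ∀ i j, μ (b i) (b j) = ∑ k, c i j k • b k) : Isomorphic μ (ofTable c) := by
  refine ⟨b.equivFun, fun x y => ?_⟩
  have : μ.compr₂ (b.equivFun : A →ₗ[ℂ] (Fin 4 → ℂ)) =
      (ofTable c).compl₁₂ (b.equivFun : A →ₗ[ℂ] (Fin 4 → ℂ)) (b.equivFun : A →ₗ[ℂ] _) := by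
    refine b.ext fun i => b.ext fun j => ?_
    rw [LinearMap.compr₂_apply, LinearMap.compl₁₂_apply, h]
    have hs (i : Fin 4) : b.equivFun (b i) = Pi.single i 1 := by
      ext j; simp [Pi.single_apply, eq_comm]
    simp only [LinearEquiv.coe_coe, map_sum, map_smul, hs, ofTable_single]
    ext k
    simp [Pi.single_apply]
  exact congrArg (fun F : A →ₗ[ℂ] A →ₗ[ℂ] (Fin 4 → ℂ) => F x y) this

theorem isomorphic_ofTable_of_span (hA : Module.finrank ℂ A = 4) {w : Fin 4 → A}
    (hw : Submodule.span ℂ (Set.range w) = ⊤) {c : Fin 4 → Fin 4 → (Fin 4 → ℂ)}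
    (h : ∀ i j, μ (w i) (w j) = ∑ k, c i j k • w k) : Isomorphic μ (ofTable c) := by
  have hli : LinearIndependent ℂ w := linearIndependent_of_top_le_span_of_card_eq_finrank hw.ge
    (by simp [hA])
  refine isomorphic_ofTable (Module.Basis.mk hli hw.ge) ?_
  simpa using h

variable {a b c v : A} {α β γ l m : ℂ}

theorem IsFrame.isomorphic_of_normal (hA : Module.finrank ℂ A = 4)
    (h : IsFrame μ a b c v α β γ 1 0) :
    ((α = 0 ∧ β = 0 ∧ γ = 0) → Isomorphic μ A41) ∧
    ((α = 0 ∧ β = 0 ∧ γ = 1) → Isomorphic μ A42) ∧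
    ((α = 0 ∧ β = 1 ∧ γ = 0) → Isomorphic μ A43) ∧
    ((α = 1 ∧ β = 1 ∧ γ = 0) → Isomorphic μ A44) ∧
    ((α = 1 ∧ β = 0 ∧ γ = 0) → Isomorphic μ A45) := by
  have hspan : Submodule.span ℂ (Set.range ![a, b, c, v]) = ⊤ := by
    rw [← h.span_eq]; congr 1; ext x; simp [eq_comm]; tauto
  -- Except for `A41`, the tables have e₃ = e₂e₁, so the third basis vector must be ba rather than c
  -- = ab.
  have hspan' : Submodule.span ℂ (Set.range ![a, b, -c + γ • v, v]) = ⊤ := by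
    set S := Submodule.span ℂ (Set.range ![a, b, -c + γ • v, v]) with hS
    have hmem (i : Fin 4) : ![a, b, -c + γ • v, v] i ∈ S := Submodule.subset_span ⟨i, rfl⟩
    have h0 : a ∈ S := hmem 0
    have h1 : b ∈ S := hmem 1
    have h2 : -c + γ • v ∈ S := hmem 2
    have h3 : v ∈ S := hmem 3
    have hc : c ∈ S := by
      simpa using (Submodule.add_mem_iff_left _ (S.smul_mem γ h3)).1 h2
    rw [eq_top_iff, ← h.span_eq, Submodule.span_le]
    rintro x (rfl | rfl | rfl | rfl) <;> assumption
  refine ⟨?_, ?_, ?_, ?_, ?_⟩ <;> rintro ⟨rfl, rfl, rfl⟩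
  · refine isomorphic_ofTable_of_span hA hspan fun i j => ?_
    fin_cases i <;> fin_cases j <;>
      simp [e₃, e₄, h.aa, h.ab, h.ba, h.bb, h.ac, h.ca, h.bc, h.cb, h.cc,
        h.vx, h.xv]
  all_goals
    refine isomorphic_ofTable_of_span hA hspan' fun i j => ?_
    fin_cases i <;> fin_cases j <;>
      simp [Fin.sum_univ_four, e₃, e₄, h.aa, h.ab, h.ba, h.bb, h.ac, h.ca, h.bc, h.cb, h.cc,
        h.vx, h.xv]

theorem IsFrame.isomorphic (hA : Module.finrank ℂ A = 4)
    (h : IsFrame μ a b c v α β γ l m) (hlm : l ≠ 0 ∨ m ≠ 0) :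
    Isomorphic μ A41 ∨ Isomorphic μ A42 ∨ Isomorphic μ A43 ∨ Isomorphic μ A44 ∨
      Isomorphic μ A45 := by
  obtain ⟨a, b, c, v, α, β, γ, h⟩ :
      ∃ a b c v α β γ, IsFrame μ a b c v α β γ (1 : ℂ) (0 : ℂ) := by
    rcases ne_or_eq l 0 with hl | rfl
    -- The new second generator -ma + lb spans the kernel of the linear form.
    · obtain ⟨a', b', c', v', h'⟩ := h.change 1 0 (-m) l (l ^ 2) (by simpa) (by simpa)
        (α' := α / l ^ 2) (β' := (m ^ 2 * α - m * l * γ + l ^ 2 * β) / l ^ 2)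
        (γ' := (-2 * m * α + l * γ) / l ^ 2) (l' := 1) (m' := 0)
        (by field_simp; ring) (by field_simp; ring) (by field_simp; ring) (by ring) (by ring)
      exact ⟨_, _, _, _, _, _, _, h'⟩
    · have hm : m ≠ 0 := by simpa using hlm
      obtain ⟨a', b', c', v', h'⟩ := h.change 0 1 1 0 (-m) (by simp) (by simpa)
        (α' := -β / m) (β' := -α / m) (γ' := -γ / m) (l' := 1) (m' := 0)
        (by field_simp; ring) (by field_simp; ring) (by field_simp; ring) (by ring) (by ring)
      exact ⟨_, _, _, _, _, _, _, h'⟩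
  clear hlm
  -- Keeping (l, m) = (1, 0) forces r = 0 and k = p²s.
  have reduce (p q s α' β' γ' : ℂ) (hp : p ≠ 0) (hs : s ≠ 0)
      (hα : α' * (p ^ 2 * s) = p ^ 2 * α + p * q * γ + q ^ 2 * β)
      (hβ : β' * (p ^ 2 * s) = s ^ 2 * β)
      (hγ : γ' * (p ^ 2 * s) = p * s * γ + 2 * q * s * β) :
      ∃ a b c v, IsFrame μ a b c v α' β' γ' (1 : ℂ) (0 : ℂ) :=
    h.change p q 0 s (p ^ 2 * s) (by simp [hp, hs]) (by simp [hp, hs])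
      (by rw [hα]) (by rw [hβ]; ring) (by rw [hγ]; ring) (by ring) (by ring)
  -- β is the value of Q at b, which spans the kernel of the linear form. For β = 0 and γ ≠ 0, the
  -- generator γa - αb is a zero of Q.
  by_cases hβ : β = 0
  · subst hβ
    by_cases hγ : γ = 0
    · subst hγ
      by_cases hα : α = 0
      · exact Or.inl ((h.isomorphic_of_normal hA).1 ⟨hα, rfl, rfl⟩)
      · obtain ⟨a', b', c', v', h'⟩ := reduce 1 0 α 1 0 0 one_ne_zero hα
          (by ring) (by ring) (by ring)
        exact Or.inr (Or.inr (Or.inr (Or.inr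
          ((h'.isomorphic_of_normal hA).2.2.2.2 ⟨rfl, rfl, rfl⟩))))
    · obtain ⟨a', b', c', v', h'⟩ := reduce γ (-α) 1 0 0 1 hγ one_ne_zero
        (by ring) (by ring) (by ring)
      exact Or.inr (Or.inl ((h'.isomorphic_of_normal hA).2.1 ⟨rfl, rfl, rfl⟩))
  -- Completing the square: this is Q(a - (γ/2β)b), a multiple of the discriminant.
  · by_cases hδ : α - γ ^ 2 / (4 * β) = 0
    · have hα : α = γ ^ 2 / (4 * β) := sub_eq_zero.1 hδ
      obtain ⟨a', b', c', v', h'⟩ := reduce 1 (-γ / (2 * β)) (1 / β) 0 1 0 one_ne_zero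
        (by simpa) (by rw [hα]; field_simp; ring) (by field_simp) (by field_simp; ring)
      exact Or.inr (Or.inr (Or.inl ((h'.isomorphic_of_normal hA).2.2.1 ⟨rfl, rfl, rfl⟩)))
    · set δ := α - γ ^ 2 / (4 * β) with hδ'
      -- Taking s = δ makes α' = 1; then β' = 1 amounts to p² = βδ.
      obtain ⟨p, hp⟩ := IsAlgClosed.exists_pow_nat_eq (β * δ) (n := 2) two_pos
      have hp0 : p ≠ 0 := by
        rintro rfl
        exact mul_ne_zero hβ hδ (by simpa using hp.symm)
      have hα : α = δ + γ ^ 2 / (4 * β) := by rw [hδ']; ring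
      obtain ⟨a', b', c', v', h'⟩ := reduce p (-(p * γ) / (2 * β)) δ 1 1 0 hp0 hδ
        (by rw [hα]; field_simp; ring) (by rw [hp]; ring) (by field_simp; ring)
      exact Or.inr (Or.inr (Or.inr (Or.inl
        ((h'.isomorphic_of_normal hA).2.2.2.1 ⟨rfl, rfl, rfl⟩))))

end Normalization

/-! ### Existence of the multiplication table -/

section Existence

variable {K : Type*} [Field K] {A : Type*} [AddCommGroup A] [Module K A]
  {μ : A →ₗ[K] A →ₗ[K] A}

/-- A nilpotent algebra of nilindex 3 generated by one element is 2-step nilpotent. -/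
theorem IsNilpotentAlg.isTwoStepNilpotent_of_singleton_sup (h : IsNilpotentAlg μ)
    (h3 : IsNilIndexThree μ) (h4 : ∀ x, μ (μ x x) (μ x x) = 0) {a : A}
    (ha : power μ 2 ⊔ Submodule.span K {a} = ⊤) : IsTwoStepNilpotent μ := by
  have hdec (x : A) : ∃ t : K, ∃ y ∈ power μ 2, x = t • a + y := by
    have hx : x ∈ power μ 2 ⊔ Submodule.span K {a} := ha ▸ trivial
    obtain ⟨y, hy, z, hz, rfl⟩ := Submodule.mem_sup.1 hx
    obtain ⟨t, rfl⟩ := Submodule.mem_span_singleton.1 hz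
    exact ⟨t, y, hy, add_comm _ _⟩
  have hdec2 (x : A) (hx : x ∈ power μ 2) : ∃ t : K, ∃ y ∈ power μ 3, x = t • μ a a + y := by
    have : power μ 2 ≤ power μ 3 ⊔ Submodule.span K {μ a a} := by
      refine power_two_le fun x y => ?_
      obtain ⟨s, x, hx, rfl⟩ := hdec x
      obtain ⟨t, y, hy, rfl⟩ := hdec y
      have e : μ (s • a + x) (t • a + y) =
          (s • μ a y + μ x (t • a + y)) + (s * t) • μ a a := by
        simp only [map_add, map_smul, LinearMap.add_apply, LinearMap.smul_apply]
        module
      rw [e]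
      exact Submodule.add_mem_sup (Submodule.add_mem _
        (Submodule.smul_mem _ _ (mul_left_mem_power _ hy)) (mul_right_mem_power _ hx))
        (Submodule.smul_mem _ _ (Submodule.mem_span_singleton_self _))
    obtain ⟨y, hy, z, hz, rfl⟩ := Submodule.mem_sup.1 (this hx)
    obtain ⟨t, rfl⟩ := Submodule.mem_span_singleton.1 hz
    exact ⟨t, y, hy, add_comm _ _⟩
  -- Modulo A³, elements of A are sa + ua² and those of A² are ta². Hence, modulo A·A³ + A³·A, A³ is
  -- spanned by a a², a² a and a²a², which are all zero.
  refine h.eq_bot_of_le_mul (power_three_le fun x y hy => ?_)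
  set S := Submodule.map₂ μ ⊤ (power μ 3) ⊔ Submodule.map₂ μ (power μ 3) ⊤
  have hl (x : A) {y : A} (hy : y ∈ power μ 3) : μ x y ∈ S :=
    Submodule.mem_sup_left (Submodule.apply_mem_map₂ _ trivial hy)
  have hr (x : A) {y : A} (hy : y ∈ power μ 3) : μ y x ∈ S :=
    Submodule.mem_sup_right (Submodule.apply_mem_map₂ _ hy trivial)
  obtain ⟨s, x, hx, rfl⟩ := hdec x
  obtain ⟨u, x, hx', rfl⟩ := hdec2 x hx
  obtain ⟨t, y, hy', rfl⟩ := hdec2 y hy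
  obtain ⟨h3l, h3r⟩ := h3 a
  have h4 := h4 a
  constructor
  · have e : μ (s • a + (u • μ a a + x)) (t • μ a a + y) =
        μ (s • a + (u • μ a a + x)) y + t • μ x (μ a a) := by
      simp only [map_add, map_smul, LinearMap.add_apply, LinearMap.smul_apply, h3r, h4]
      module
    rw [e]
    exact S.add_mem (hl _ hy') (S.smul_mem _ (hr _ hx'))
  · have e : μ (t • μ a a + y) (s • a + (u • μ a a + x)) =
        μ y (s • a + (u • μ a a + x)) + t • μ (μ a a) x := by
      simp only [map_add, map_smul, LinearMap.add_apply, LinearMap.smul_apply, h3l, h4]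
      module
    rw [e]
    exact S.add_mem (hr _ hy') (S.smul_mem _ (hl _ hx'))

variable [CharZero K]

/-- The shape of a 4-dimensional nilpotent algebra of nilindex 3 with `A³ ≠ 0`. -/
theorem IsNilpotentAlg.exists_generators (h : IsNilpotentAlg μ) (hA : Module.finrank K A = 4)
    (h3 : IsNilIndexThree μ) (h4 : ∀ x, μ (μ x x) (μ x x) = 0) (hn : ¬ IsTwoStepNilpotent μ) :
    ∃ a b v : A, Submodule.span K {a, b, μ a b, v} = ⊤ ∧ power μ 3 = K ∙ v ∧
      (∀ x, μ v x = 0 ∧ μ x v = 0) ∧ ∀ x, μ x x ∈ power μ 3 := by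
  have hfd : FiniteDimensional K A := FiniteDimensional.of_finrank_pos (by omega)
  have hnt : Nontrivial A := Module.nontrivial_of_finrank_pos (R := K) (by omega)
  have hP3 : power μ 3 ≠ ⊥ := hn
  have d2 := Submodule.finrank_lt_finrank_of_lt h.power_two_lt_top
  have d3 := Submodule.finrank_lt_finrank_of_lt (h.power_three_lt_power_two hP3)
  have d3' : Module.finrank K (power μ 3) ≠ 0 := fun h0 =>
    hP3 (Submodule.finrank_eq_zero.1 h0)
  rw [finrank_top, hA] at d2
  have d2' : Module.finrank K (power μ 2) ≠ 3 := fun h0 => by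
    obtain ⟨u, hu⟩ := exists_span_sup_eq_top (power μ 2) (k := 1) (by omega)
    refine hn (h.isTwoStepNilpotent_of_singleton_sup h3 h4 (a := u 0) ?_)
    rw [← hu]; congr 2
    ext x; simp [eq_comm]
  have e2 : Module.finrank K (power μ 2) = 2 := by omega
  have e3 : Module.finrank K (power μ 3) = 1 := by omega
  obtain ⟨u, hu⟩ := exists_span_sup_eq_top (power μ 2) (k := 2) (by omega)
  obtain ⟨v, hv⟩ : ∃ v, power μ 3 = K ∙ v := by
    obtain ⟨v, _, hv⟩ := finrank_eq_one_iff'.1 e3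
    refine ⟨v, le_antisymm (fun x hx => ?_) (by simp)⟩
    obtain ⟨t, ht⟩ := hv ⟨x, hx⟩
    exact Submodule.mem_span_singleton.2 ⟨t, congrArg Subtype.val ht⟩
  have hv3 : v ∈ power μ 3 := hv ▸ Submodule.mem_span_singleton_self v
  have hv2 : v ∈ power μ 2 := power_three_le_power_two hv3
  have hvx (x : A) : μ v x = 0 :=
    h.mul_eq_zero_of_mem_span' (hv ▸ mul_right_mem_power x hv2)
  have hxv (x : A) : μ x v = 0 :=
    h.mul_eq_zero_of_mem_span (hv ▸ mul_left_mem_power x hv2)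
  obtain ⟨w, hw2, hw3⟩ := SetLike.exists_of_lt (h.power_three_lt_power_two hP3)
  have key {c : A} (hc2 : c ∈ power μ 2) (hc3 : c ∉ power μ 3) :
      ∀ x ∈ power μ 2, ∃ s t : K, x = s • c + t • v := by
    have hlt : power μ 3 < power μ 3 ⊔ K ∙ c := by
      refine lt_of_le_of_ne le_sup_left fun he => hc3 ?_
      rw [he]
      exact Submodule.mem_sup_right (Submodule.mem_span_singleton_self c)
    have hle : power μ 3 ⊔ K ∙ c ≤ power μ 2 :=
      sup_le power_three_le_power_two (by simpa using hc2)
    have heq := Submodule.eq_of_le_of_finrank_le hle (by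
      have := Submodule.finrank_lt_finrank_of_lt hlt
      omega)
    intro x hx
    rw [← heq, hv] at hx
    obtain ⟨y, hy, z, hz, rfl⟩ := Submodule.mem_sup.1 hx
    obtain ⟨s, rfl⟩ := Submodule.mem_span_singleton.1 hz
    obtain ⟨t, rfl⟩ := Submodule.mem_span_singleton.1 hy
    exact ⟨s, t, add_comm _ _⟩
  obtain ⟨y, hy⟩ : ∃ y, μ y w ≠ 0 ∨ μ w y ≠ 0 := by
    by_contra! hw
    refine hP3 (eq_bot_iff.2 (power_three_le fun x z hz => ?_))
    obtain ⟨s, t, rfl⟩ := key hw2 hw3 z hz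
    simp [hvx, hxv, hw x]
  -- Writing x² = sw + tv, the vanishing of both cubes gives s·xw = s·wx = 0.
  have sq_of_ne (x : A) (hx : μ x w ≠ 0 ∨ μ w x ≠ 0) : μ x x ∈ power μ 3 := by
    obtain ⟨s, t, hst⟩ := key hw2 hw3 (μ x x) (mul_mem_power_two x x)
    have h1 := (h3 x).1
    have h2 := (h3 x).2
    rw [hst] at h1 h2 ⊢
    simp only [map_add, map_smul, LinearMap.add_apply, LinearMap.smul_apply, hvx, hxv, smul_zero,
      add_zero, smul_eq_zero] at h1 h2
    have hs : s = 0 := by tauto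
    simpa [hs] using Submodule.smul_mem _ t hv3
  have sq_mem (x : A) : μ x x ∈ power μ 3 := by
    by_cases hx : μ x w ≠ 0 ∨ μ w x ≠ 0
    · exact sq_of_ne x hx
    push Not at hx
    -- If x kills w, then x ± y still act on w as ±y does, and (x + y)² + (x - y)² - 2y² = 2x².
    have h1 := sq_of_ne (x + y) (by simpa [hx] using hy)
    have h2 := sq_of_ne (x - y) (by simpa [hx] using hy)
    have h3 := sq_of_ne y hy
    refine (Submodule.smul_mem_iff _ (two_ne_zero (α := K))).1 ?_
    convert Submodule.sub_mem _ (Submodule.add_mem _ h1 h2) (Submodule.smul_mem _ (2 : K) h3)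
      using 1
    simp only [map_add, map_sub, LinearMap.add_apply, LinearMap.sub_apply]
    module
  have hswap (x y : A) : μ x y + μ y x ∈ power μ 3 := by
    convert Submodule.sub_mem _ (Submodule.sub_mem _ (sq_mem (x + y)) (sq_mem x)) (sq_mem y)
      using 1
    simp only [map_add, LinearMap.add_apply]
    module
  have hdec (x : A) : ∃ s t : K, ∃ y ∈ power μ 2, x = s • u 0 + t • u 1 + y := by
    have hx : x ∈ power μ 2 ⊔ Submodule.span K (Set.range u) := hu ▸ trivial
    obtain ⟨y, hy, z, hz, rfl⟩ := Submodule.mem_sup.1 hx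
    obtain ⟨f, rfl⟩ := (Submodule.mem_span_range_iff_exists_fun K).1 hz
    exact ⟨f 0, f 1, y, hy, by simp [Fin.sum_univ_two, add_comm]⟩
  -- Otherwise all products of the generators lie in A³, and A² = A³.
  have hc : μ (u 0) (u 1) ∉ power μ 3 := by
    intro hc
    have hc' : μ (u 1) (u 0) ∈ power μ 3 :=
      (Submodule.add_mem_iff_right _ hc).1 (hswap _ _)
    refine (h.power_three_lt_power_two hP3).not_ge (power_two_le fun x y => ?_)
    obtain ⟨s, t, x, hx, rfl⟩ := hdec x
    obtain ⟨s', t', y, hy, rfl⟩ := hdec y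
    have e : μ (s • u 0 + t • u 1 + x) (s' • u 0 + t' • u 1 + y) =
        μ x (s' • u 0 + t' • u 1 + y) + μ (s • u 0 + t • u 1) y
          + (s * s') • μ (u 0) (u 0) + (t * t') • μ (u 1) (u 1)
          + (s * t') • μ (u 0) (u 1) + (t * s') • μ (u 1) (u 0) := by
      simp only [map_add, map_smul, LinearMap.add_apply, LinearMap.smul_apply]
      module
    rw [e]
    refine Submodule.add_mem _ (Submodule.add_mem _ (Submodule.add_mem _ (Submodule.add_mem _
      (Submodule.add_mem _ (mul_right_mem_power _ hx) (mul_left_mem_power _ hy)) ?_) ?_) ?_) ?_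
    all_goals exact Submodule.smul_mem _ _ (by first | exact sq_mem _ | assumption)
  refine ⟨u 0, u 1, v, ?_, hv, fun x => ⟨hvx x, hxv x⟩, sq_mem⟩
  refine eq_top_iff.2 fun x _ => ?_
  obtain ⟨s, t, x, hx, rfl⟩ := hdec x
  obtain ⟨s', t', rfl⟩ := key (mul_mem_power_two _ _) hc x hx
  have hm {z : A} (hz : z ∈ ({u 0, u 1, μ (u 0) (u 1), v} : Set A)) (t : K) :
      t • z ∈ Submodule.span K ({u 0, u 1, μ (u 0) (u 1), v} : Set A) :=
    Submodule.smul_mem _ _ (Submodule.subset_span hz)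
  exact Submodule.add_mem _ (Submodule.add_mem _ (hm (by simp) _) (hm (by simp) _))
    (Submodule.add_mem _ (hm (by simp) _) (hm (by simp) _))

/-- Once squares lie in Kv, only ca = -ac, cb = -bc and cc = 0 are missing. Either identity supplies
them when evaluated on generators and c. -/
theorem IsNilpotentAlg.exists_isFrame (h : IsNilpotentAlg μ) (hA : Module.finrank K A = 4)
    (hμ : IsABD μ ∨ IsSymmetricLeibniz μ) (hn : ¬ IsTwoStepNilpotent μ) :
    ∃ (a b c v : A) (α β γ l m : K), IsFrame μ a b c v α β γ l m ∧ (l ≠ 0 ∨ m ≠ 0) := by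
  have h3 : IsNilIndexThree μ :=
    hμ.elim IsABD.isNilIndexThree IsSymmetricLeibniz.isNilIndexThree
  have h4 : ∀ x, μ (μ x x) (μ x x) = 0 :=
    hμ.elim IsABD.sq_mul_sq IsSymmetricLeibniz.sq_mul_sq
  obtain ⟨a, b, v, hspan, hP3, hv, hsq⟩ := h.exists_generators hA h3 h4 hn
  have hvx := fun x => (hv x).1
  have hxv := fun x => (hv x).2
  obtain ⟨c, hc⟩ : ∃ c, μ a b = c := ⟨_, rfl⟩
  have hc2 : c ∈ power μ 2 := hc ▸ mul_mem_power_two a b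
  have hP {x : A} (hx : x ∈ power μ 3) : ∃ t : K, x = t • v := by
    rw [hP3] at hx
    obtain ⟨t, ht⟩ := Submodule.mem_span_singleton.1 hx
    exact ⟨t, ht.symm⟩
  obtain ⟨α, hα⟩ := hP (hsq a)
  obtain ⟨β, hβ⟩ := hP (hsq b)
  obtain ⟨l, hl⟩ := hP (mul_left_mem_power a hc2)
  obtain ⟨m, hm⟩ := hP (mul_left_mem_power b hc2)
  obtain ⟨l', hl'⟩ := hP (mul_right_mem_power a hc2)
  obtain ⟨m', hm'⟩ := hP (mul_right_mem_power b hc2)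
  obtain ⟨k, hk⟩ := hP (mul_left_mem_power c hc2)
  obtain ⟨δ, hδ⟩ := hP (hsq (a + b))
  have hba : μ b a = -c + (δ - α - β) • v := by
    simp only [map_add, LinearMap.add_apply, hα, hβ, hc] at hδ
    linear_combination (norm := module) hδ
  rw [hc] at hspan
  have hrel : l' • v = -(l • v) ∧ m' • v = -(m • v) ∧ k • v = 0 := by
    rcases hμ with hμ | hμ
    · have i1 := hμ.1 a a b
      have i2 := hμ.1 b a b
      have i3 := hμ.1 b a c
      simp only [circ, map_add, map_neg, map_smul, LinearMap.add_apply, LinearMap.neg_apply,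
        LinearMap.smul_apply, hα, hβ, hc, hba, hl, hm, hl', hm', hk, hvx, hxv] at i1 i2 i3
      refine ⟨?_, ?_, ?_⟩
      · linear_combination (norm := module) i1
      · linear_combination (norm := module) -i2
      · linear_combination (norm := module) (-1 / 2 : K) • i3
    · have i1 := hμ.1 a b a
      have i2 := hμ.1 b a b
      have i3 := hμ.1 c a b
      simp only [map_add, map_neg, map_smul, LinearMap.add_apply, LinearMap.neg_apply,
        LinearMap.smul_apply, hα, hβ, hc, hba, hl, hm, hl', hm', hk, hvx, hxv] at i1 i2 i3
      refine ⟨?_, ?_, ?_⟩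
      · linear_combination (norm := module) -i1
      · linear_combination (norm := module) i2
      · linear_combination (norm := module) i3
  obtain ⟨r1, r2, r3⟩ := hrel
  have hF : IsFrame μ a b c v α β (δ - α - β) l m :=
    ⟨hspan, hα, hc, hba, hβ, hl, hl'.trans r1, hm, hm'.trans r2, hk.trans r3, hvx, hxv⟩
  refine ⟨a, b, c, v, α, β, _, l, m, hF, ?_⟩
  -- If l = m = 0, all triple products vanish, so A³ = 0.
  by_contra! hlm
  obtain ⟨rfl, rfl⟩ := hlm
  obtain ⟨f, g, hfg⟩ := hF.exists_forms
  refine hn (eq_bot_iff.2 (power_three_le fun x y hy => ?_))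
  have : power μ 2 ≤ LinearMap.ker μ ⊓ LinearMap.ker μ.flip := by
    refine power_two_le fun y z => ⟨?_, ?_⟩ <;> rw [SetLike.mem_coe, LinearMap.mem_ker]
    · ext x; simpa using (hfg y z x).2
    · ext x; simpa using (hfg x y z).1
  obtain ⟨k1, k2⟩ := this hy
  rw [SetLike.mem_coe, LinearMap.mem_ker] at k1 k2
  exact ⟨by simpa using congrArg (fun F => F x) k2, by simpa using congrArg (fun F => F x) k1⟩

end Existence

/-! ### An infinite family of nilindex 3 -/

section Family

/-- The algebra `e₁e₂ = e₃`, `e₂e₁ = -e₃`, `e₁e₃ = e₄`, `e₃e₁ = t e₄`. -/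
noncomputable def nilFamily (t : ℂ) : (Fin 4 → ℂ) →ₗ[ℂ] (Fin 4 → ℂ) →ₗ[ℂ] (Fin 4 → ℂ) :=
  ofTable ![![     0, e₃, e₄, 0],
            ![   -e₃,  0,  0, 0],
            ![t • e₄,  0,  0, 0],
            ![     0,  0,  0, 0]]

theorem nilFamily_apply (t : ℂ) (x y : Fin 4 → ℂ) :
    nilFamily t x y = ![0, 0, x 0 * y 1 - x 1 * y 0, x 0 * y 2 + t * (x 2 * y 0)] := by
  ext i
  fin_cases i <;> simp [nilFamily, ofTable, Fin.sum_univ_four, e₃, e₄] <;> ring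

theorem isNilpotentAlg_nilFamily (t : ℂ) : IsNilpotentAlg (nilFamily t) := by
  have h2 : power (nilFamily t) 2 ≤
      LinearMap.ker (LinearMap.proj (R := ℂ) (φ := fun _ : Fin 4 => ℂ) 0) ⊓
      LinearMap.ker (LinearMap.proj (R := ℂ) (φ := fun _ : Fin 4 => ℂ) 1) :=
    power_two_le fun x y => by simp [nilFamily_apply]
  have h2' : ∀ x ∈ power (nilFamily t) 2, x 0 = 0 ∧ x 1 = 0 := fun x hx => by simpa using h2 hx
  have h3 : power (nilFamily t) 3 ≤
      LinearMap.ker (LinearMap.proj (R := ℂ) (φ := fun _ : Fin 4 => ℂ) 2) :=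
    power_three_le fun x y hy => by simp [nilFamily_apply, h2' y hy]
  have h3' : ∀ x ∈ power (nilFamily t) 3, x 2 = 0 := fun x hx => by simpa using h3 hx
  refine ⟨4, eq_bot_iff.2 (power_four_le (fun x y hy => ?_) fun x hx y hy => ?_)⟩
  · have h' := h2' y (power_three_le_power_two hy)
    constructor <;> rw [Submodule.mem_bot] <;> ext i <;> fin_cases i <;>
      simp [nilFamily_apply, h', h3' y hy]
  · rw [Submodule.mem_bot]
    ext i
    fin_cases i <;> simp [nilFamily_apply, h2' x hx, h2' y hy]

theorem isNilIndexThree_nilFamily (t : ℂ) : IsNilIndexThree (nilFamily t) := by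
  intro x
  constructor <;> ext i <;> fin_cases i <;> simp [nilFamily_apply] <;> ring_nf <;> simp

/-- The first identity at e₁, e₁, e₂ reduces to e₁ ∘ e₃ = (1 + t)e₄ = 0. -/
theorem not_isABD_nilFamily {t : ℂ} (ht : 1 + t ≠ 0) : ¬ IsABD (nilFamily t) := by
  intro h
  have h1 := congrFun (h.1 e₁ e₁ e₂) 3
  simp [circ, nilFamily_apply, e₁, e₂] at h1
  exact ht (by linear_combination h1)

/-- The law (xy)z = t z(xy) is transported by isomorphisms, and it determines t because e₁(e₁e₂) =
e₄ ≠ 0. -/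
theorem eq_of_isomorphic_nilFamily {s t : ℂ} (h : Isomorphic (nilFamily s) (nilFamily t)) :
    s = t := by
  obtain ⟨φ, hφ⟩ := h
  have key (t : ℂ) (x y z : Fin 4 → ℂ) : nilFamily t (nilFamily t x y) z =
      t • nilFamily t z (nilFamily t x y) := by
    ext i
    fin_cases i <;> simp [nilFamily_apply, mul_comm]
  have h1 : φ (nilFamily s (nilFamily s e₁ e₂) e₁) =
      t • φ (nilFamily s e₁ (nilFamily s e₁ e₂)) := by
    simp only [hφ, key t]
  replace h1 := φ.injective (h1.trans (φ.map_smul _ _).symm)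
  rw [key s e₁ e₂ e₁] at h1
  simpa [nilFamily_apply, e₁, e₂] using congrFun h1 3

end Family

end ABD

theorem theorem5p4 :
    -- the classification
    (∀ (A : Type*) [AddCommGroup A] [Module ℂ A] (μ : A →ₗ[ℂ] A →ₗ[ℂ] A),
      Module.finrank ℂ A = 4 → ABD.IsNilpotentAlg μ → ABD.IsABD μ →
        ABD.IsTwoStepNilpotent μ ∨ ABD.Isomorphic μ ABD.A41 ∨ ABD.Isomorphic μ ABD.A42 ∨
          ABD.Isomorphic μ ABD.A43 ∨ ABD.Isomorphic μ ABD.A44 ∨ ABD.Isomorphic μ ABD.A45) ∧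
    -- the two classes of 4-dimensional algebras coincide
    (∀ (A : Type*) [AddCommGroup A] [Module ℂ A] (μ : A →ₗ[ℂ] A →ₗ[ℂ] A),
      Module.finrank ℂ A = 4 →
        (ABD.IsNilpotentAlg μ ∧ ABD.IsSymmetricLeibniz μ ↔
          ABD.IsNilpotentAlg μ ∧ ABD.IsABD μ)) ∧
    -- infinitely many isomorphism classes outside the class
    (∃ f : ℕ → ((Fin 4 → ℂ) →ₗ[ℂ] (Fin 4 → ℂ) →ₗ[ℂ] (Fin 4 → ℂ)),
      (∀ n, ABD.IsNilpotentAlg (f n) ∧ ABD.IsNilIndexThree (f n) ∧ ¬ ABD.IsABD (f n)) ∧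
      ∀ m n, m ≠ n → ¬ ABD.Isomorphic (f m) (f n))
 := by
  refine ⟨fun A _ _ μ hA hN hμ => ?_, fun A _ _ μ hA => ?_, ?_⟩
  · by_cases h2 : ABD.IsTwoStepNilpotent μ
    · exact Or.inl h2
    · obtain ⟨a, b, c, v, α, β, γ, l, m, hF, hlm⟩ := hN.exists_isFrame hA (Or.inl hμ) h2
      exact Or.inr (hF.isomorphic hA hlm)
  · refine and_congr_right fun hN => ?_
    by_cases h2 : ABD.IsTwoStepNilpotent μ
    · exact ⟨fun _ => h2.isABD, fun _ => h2.isSymmetricLeibniz⟩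
    · constructor <;> intro hμ
      · obtain ⟨a, b, c, v, α, β, γ, l, m, hF, -⟩ := hN.exists_isFrame hA (Or.inr hμ) h2
        exact hF.isABD
      · obtain ⟨a, b, c, v, α, β, γ, l, m, hF, -⟩ := hN.exists_isFrame hA (Or.inl hμ) h2
        exact hF.isSymmetricLeibniz
  · refine ⟨fun n => ABD.nilFamily n, fun n => ⟨ABD.isNilpotentAlg_nilFamily _,
      ABD.isNilIndexThree_nilFamily _, ABD.not_isABD_nilFamily ?_⟩, fun m n hmn h => hmn ?_⟩
    · exact_mod_cast (by omega : 1 + n ≠ 0)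
    · exact_mod_cast ABD.eq_of_isomorphic_nilFamily h
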